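/- Fix $L\in\mathbb N$ and, for each hop $j\in\{1,2\}$, real parameters $a_{i_j}\ge 0$, $b_{i_j}>0$, $c_{i_j}>0$ ($1\le i_j\le L$), $\xi_j>0$, $A_{0_j}>0$, $\bar\gamma_j>0$. Put $\beta_{i_j}=\dfrac{c_{i_j}}{A_{0_j}\bar\gamma_j}$ and let $\Gamma(s,x)=\int_x^\infty t^{s-1}e^{-t}\,dt$ be the upper incomplete Gamma function. Let $\gamma_1,\gamma_2$ be independent random variables such that $\gamma_j$ has the density $$f_{\gamma_j}(x)=\sum_{i_j=1}^{L}\frac{a_{i_j}c_{i_j}^{\xi_j^2-b_{i_j}}\xi_j^2\,x^{\xi_j^2-1}}{(A_{0_j}\bar\gamma_j)^{\xi_j^2}}\,\Gamma\!\left(b_{i_j}-\xi_j^2,\ \beta_{i_j}x\right),\qquad x>0 .$$ Assume that all $b_{i_j}-\xi_j^2$ are positive integers and that $\xi_1^2$ is a positive integer, and put $$\Xi(i_j)=\frac{a_{i_j}c_{i_j}^{\xi_j^2-b_{i_j}+k_j}\,\xi_j^2\,(b_{i_j}-\xi_j^2-1)!}{k_j!\,(A_{0_j}\bar\gamma_j)^{\xi_j^2+k_j}}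 .$$ For $U>0$ let $\gamma_{\rm Fixed}=\dfrac{\gamma_1\gamma_2}{\gamma_2+U}$ be the end-to-end SNR of fixed-gain amplify-and-forward relaying, and for $P,Q>0$ let $$\overline P_b=\frac{Q^P}{2\Gamma(P)}\int_0^\infty z^{P-1}e^{-Qz}\,\mathbb P(\gamma_{\rm Fixed}\le z)\,dz$$ be its average bit-error rate. Then, for every $U>0$, $$\begin{aligned}\overline P_b=\frac12-&\sum_{i_1=1}^{L}\ \sum_{k_1=0}^{b_{i_1}-\xi_1^2-1}\ \sum_{r_1=0}^{\xi_1^2+k_1-1}\ \sum_{i_2=1}^{L}\ \sum_{k_2=0}^{b_{i_2}-\xi_2^2-1}\ \sum_{s=0}^{r_1}\binom{r_1}{s}\,\Xi(i_1)\,\Xi(i_2)\\ &\times\frac{(\xi_1^2+k_1-1)!\;\beta_{i_1}^{\frac{\xi_2^2+k_2-s-1}{2}+r_1-\xi_1^2-k_1}\;U^{\frac{\xi_2^2+k_2+s-1}{2}}\;Q^P\;\Gamma(\xi_2^2+k_2-s+r_1+P)\,\Gamma(r_1+P)}{2\,r_1!\,\Gamma(P)\;\beta_{i_2}^{\frac{\xi_2^2+k_2-s+1}{2}}\,(\beta_{i_1}+Q)^{\frac{\xi_2^2+k_2-s+2r_1+2P-1}{2}}\;\exp\!\left(-\frac{\beta_{i_1}\beta_{i_2}U}{2(\beta_{i_1}+Q)}\right)}\\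 &\times W_{-\frac{\xi_2^2+k_2-s+2r_1+2P-1}{2},\ \frac{\xi_2^2+k_2-s}{2}}\!\left(\frac{\beta_{i_1}\beta_{i_2}U}{\beta_{i_1}+Q}\right),\end{aligned}$$ where $W_{\kappa,\mu}$ is the Whittaker function, given for $z>0$ and $\mu-\kappa+\frac12>0$ by $$W_{\kappa,\mu}(z)=\frac{e^{-z/2}z^{\mu+1/2}}{\Gamma(\mu-\kappa+\frac12)}\int_0^\infty e^{-zt}\,t^{\mu-\kappa-1/2}(1+t)^{\mu+\kappa-1/2}\,dt .$$ This applies in particular to the statistical gain constant $U=\left(\mathbb E\left[\frac{1}{\gamma_1+1}\right]\right)^{-1}$, which is positive and equals $$U=\left[\sum_{i_1=1}^{L}\sum_{k_1=0}^{b_{i_1}-\xi_1^2-1}\frac{\Xi(i_1)\,\Gamma(\xi_1^2+k_1)}{\exp(-\beta_{i_1})}\,\Gamma\!\left(1-\xi_1^2-k_1,\ \beta_{i_1}\right)\right]^{-1}.$$ -/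

import Mathlib

open MeasureTheory ProbabilityTheory Set
open scoped Nat

noncomputable section

/-- The upper incomplete Gamma function `Γ(s, x) = ∫_x^∞ t^(s-1) e^(-t) dt` (for `x > 0`, `s` real). -/
def upperGamma (s x : ℝ) : ℝ :=
  ∫ t in Ioi x, t ^ (s - 1) * Real.exp (-t)

/-- Whittaker's function `W_{κ,μ}(z)` for real parameters with `μ - κ + 1/2 > 0` and `z > 0`:
`W_{κ,μ}(z) = e^(-z/2) z^(μ+1/2) / Γ(μ-κ+1/2) · ∫_0^∞ e^(-zt) t^(μ-κ-1/2) (1+t)^(μ+κ-1/2) dt`.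
In this range it covers integer values of `2μ`, where the expression of `W` as a combination of
`M_{κ,μ}` and `M_{κ,-μ}` breaks down. -/
def whittakerW (κ μ z : ℝ) : ℝ :=
  Real.exp (-z / 2) * z ^ (μ + 1 / 2) / Real.Gamma (μ - κ + 1 / 2) *
    ∫ t in Ioi (0 : ℝ),
      Real.exp (-(z * t)) * t ^ (μ - κ - 1 / 2) * (1 + t) ^ (μ + κ - 1 / 2)

/-- Parameters of one hop: mixture-Gamma turbulence (`L` components `a i, b i, c i`), pointing-error
parameter `ξ`, pointing loss `A₀`, and average SNR `γbar`. -/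
structure Hop (L : ℕ) where
  a : Fin L → ℝ
  b : Fin L → ℝ
  c : Fin L → ℝ
  ξ : ℝ
  A₀ : ℝ
  γbar : ℝ
  a_nonneg : ∀ i, 0 ≤ a i
  b_pos : ∀ i, 0 < b i
  c_pos : ∀ i, 0 < c i
  ξ_pos : 0 < ξ
  A₀_pos : 0 < A₀
  γbar_pos : 0 < γbar

namespace Hop

variable {L : ℕ} (h : Hop L)

/-- The exponential rate `c_i / (A₀ γbar)` of component `i`. -/
def rate (i : Fin L) : ℝ := h.c i / (h.A₀ * h.γbar)

/-- The density, on `x > 0`, of the SNR of the hop. -/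
def snrPDF (x : ℝ) : ℝ :=
  ∑ i, h.a i * h.c i ^ (h.ξ ^ 2 - h.b i) * h.ξ ^ 2 * x ^ (h.ξ ^ 2 - 1)
      / (h.A₀ * h.γbar) ^ (h.ξ ^ 2)
    * upperGamma (h.b i - h.ξ ^ 2) (h.c i / (h.A₀ * h.γbar) * x)

/-- The law on the real line with density `snrPDF` on `(0, ∞)`. -/
def snrLaw : Measure ℝ :=
  (volume.restrict (Ioi 0)).withDensity fun x => ENNReal.ofReal (h.snrPDF x)

/-- The coefficient `Ξ(i)` (it also depends on `k`); `d` stands for the positive integer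
`b i - ξ²`. -/
def Xi (d : ℕ) (i : Fin L) (k : ℕ) : ℝ :=
  h.a i * h.c i ^ (h.ξ ^ 2 - h.b i + k) * h.ξ ^ 2 * ((d - 1)! : ℝ)
    / ((k ! : ℝ) * (h.A₀ * h.γbar) ^ (h.ξ ^ 2 + k))

end Hop

variable {Ω : Type*} [MeasurableSpace Ω]

/-- End-to-end SNR of fixed-gain amplify-and-forward relaying. -/
def snrFixed (U : ℝ) (γ₁ γ₂ : Ω → ℝ) (ω : Ω) : ℝ :=
  γ₁ ω * γ₂ ω / (γ₂ ω + U)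

/-- The fixed-gain constant `(𝔼[1 / (γ₁ + 1)])⁻¹`. -/
def gainConstant (μ : Measure Ω) (γ₁ : Ω → ℝ) : ℝ :=
  (∫ ω, 1 / (γ₁ ω + 1) ∂μ)⁻¹

/-- Average bit-error rate of an SNR `γ` with modulation parameters `P` and `Q`:
`Q^P / (2 Γ(P)) · ∫_0^∞ z^(P-1) e^(-Qz) F_γ(z) dz`, where `F_γ` is the distribution function. -/
def aber (μ : Measure Ω) (P Q : ℝ) (γ : Ω → ℝ) : ℝ :=
  Q ^ P / (2 * Real.Gamma P) *
    ∫ z in Ioi (0 : ℝ), z ^ (P - 1) * Real.exp (-(Q * z)) * μ.real {ω | γ ω ≤ z}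

end

/-! When `b i - ξ²` is a positive integer, the incomplete Gamma function is an exponential times a
polynomial, so each SNR density is a finite combination of kernels `x ^ (ξ² + k - 1) * exp (-βx)`
(`snrPDF_eq_sum`). If moreover `ξ₁²` is an integer, the tail of `γ₁` is a finite combination of
`(βx) ^ r * exp (-βx)` (`snrLaw_real_Ioi`).

Almost surely the SNR exceeds `z` iff `γ₁ > z * v` with `v = 1 + U / γ₂`, so by independence its
distribution function is 1 minus the mean over `γ₂` of the tail of `γ₁` at `z * v`
(`measureReal_snrFixed_le`). The constant 1 contributes the `1/2`. In the rest, Fubini lets the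
`z`-integral go first; it is a Gamma integral and leaves `v ^ r * (Q + βv) ^ (-(P + r))`
(`integral_gamma_weight`). Expanding `v ^ r` binomially and integrating over `γ₂` gives integrals of
`y ^ (n - 1) * exp (-β₂ y) * (B + C / y) ^ (-p)`, which become Whittaker's integral after rescaling
`y` (`integral_rpow_mul_exp_mul_add_div_rpow`).

The gain constant comes from writing `1 / (x + 1)` as a Laplace integral. -/

/-! ### Incomplete Gamma integrals. -/

theorem hasDerivAt_sum_range_pow_div_factorial (β : ℝ) (n : ℕ) (t : ℝ) :
    HasDerivAt (fun t : ℝ => ∑ r ∈ Finset.range (n + 1), (β * t) ^ r / (r ! : ℝ))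
      (β * ∑ r ∈ Finset.range n, (β * t) ^ r / (r ! : ℝ)) t := by
  induction n with
  | zero => simpa using hasDerivAt_const t (1 : ℝ)
  | succ n ih =>
    simp_rw [Finset.sum_range_succ _ (n + 1)]
    rw [Finset.sum_range_succ _ n, mul_add]
    refine ih.add ?_
    have h1 : HasDerivAt (fun t : ℝ => (β * t) ^ (n + 1)) _ t :=
      ((hasDerivAt_id t).const_mul β).pow (n + 1)
    refine (h1.div_const _).congr_deriv ?_
    have : ((n + 1 : ℕ) ! : ℝ) = (n + 1) * n ! := by push_cast [Nat.factorial_succ]; ring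
    rw [this]
    have h2 : (n ! : ℝ) ≠ 0 := by positivity
    have h3 : (n + 1 : ℝ) ≠ 0 := by positivity
    simp
    field_simp

theorem integrableOn_rpow_mul_exp_neg_mul {ν β : ℝ} (hν : 0 < ν) (hβ : 0 < β) :
    IntegrableOn (fun t : ℝ => t ^ (ν - 1) * Real.exp (-(β * t))) (Ioi 0) := by
  have := integrableOn_rpow_mul_exp_neg_mul_rpow (p := 1) (s := ν - 1) (b := β)
    (by linarith) one_pos hβ
  simpa using this

/-- Differentiating a truncated exponential series drops its top term, so in the derivative of `exp
(-βt)` times that series everything cancels except the top term. This gives an explicit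
antiderivative vanishing at infinity. -/
theorem integral_Ioi_pow_mul_exp_neg_mul (n : ℕ) {β x : ℝ} (hβ : 0 < β) (hx : 0 ≤ x) :
    ∫ t in Ioi x, t ^ n * Real.exp (-(β * t)) =
      n ! * Real.exp (-(β * x)) * (∑ r ∈ Finset.range (n + 1), (β * x) ^ r / (r ! : ℝ))
        / β ^ (n + 1) := by
  set F : ℝ → ℝ := fun t => -(n ! * Real.exp (-(β * t)) *
    (∑ r ∈ Finset.range (n + 1), (β * t) ^ r / (r ! : ℝ)) / β ^ (n + 1)) with hF
  have hderiv : ∀ t ∈ Ici x, HasDerivAt F (t ^ n * Real.exp (-(β * t))) t := by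
    intro t _
    have h1 := hasDerivAt_sum_range_pow_div_factorial β n t
    have h2 : HasDerivAt (fun t : ℝ => Real.exp (-(β * t))) (Real.exp (-(β * t)) * -β) t := by
      simpa using (((hasDerivAt_id t).const_mul β).neg).exp
    refine ((((h2.const_mul (n ! : ℝ)).mul h1).div_const (β ^ (n + 1))).neg).congr_deriv ?_
    rw [Finset.sum_range_succ]
    have h3 : (n ! : ℝ) ≠ 0 := by positivity
    field_simp
    ring
  have hint : IntegrableOn (fun t : ℝ => t ^ n * Real.exp (-(β * t))) (Ioi x) := by
    refine (IntegrableOn.congr_fun (integrableOn_rpow_mul_exp_neg_mul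
      (ν := n + 1) (by positivity) hβ) ?_ measurableSet_Ioi).mono_set (Ioi_subset_Ioi hx)
    intro t _
    simp
  have hlim : Filter.Tendsto F Filter.atTop (nhds 0) := by
    have h1 : ∀ r ∈ Finset.range (n + 1), Filter.Tendsto
        (fun t : ℝ => (β * t) ^ r * Real.exp (-(β * t)) / (r ! : ℝ)) Filter.atTop (nhds 0) := by
      intro r _
      have := ((Real.tendsto_pow_mul_exp_neg_atTop_nhds_zero r).comp
        (Filter.tendsto_id.const_mul_atTop hβ)).div_const (r ! : ℝ)
      simpa using this
    have h2 := ((tendsto_finsetSum _ h1).const_mul (n ! : ℝ)).div_const (β ^ (n + 1)) |>.neg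
    simp only [Finset.sum_const_zero, mul_zero, zero_div, neg_zero] at h2
    refine h2.congr fun t => ?_
    simp only [hF, Finset.mul_sum]
    congr 2
    refine Finset.sum_congr rfl fun r _ => ?_
    ring
  rw [integral_Ioi_of_hasDerivAt_of_tendsto' hderiv hint hlim]
  simp [hF]

theorem upperGamma_natCast {d : ℕ} (hd : 0 < d) {x : ℝ} (hx : 0 ≤ x) :
    upperGamma d x =
      (d - 1)! * Real.exp (-x) * ∑ k ∈ Finset.range d, x ^ k / (k ! : ℝ) := by
  obtain ⟨n, rfl⟩ := Nat.exists_eq_succ_of_ne_zero hd.ne'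
  have := integral_Ioi_pow_mul_exp_neg_mul n one_pos hx
  simp only [one_mul, one_pow, div_one] at this
  simp [upperGamma, this]

/-- Laplace transform of `x ^ (ν - 1) / (x + 1)`. -/
theorem integral_rpow_mul_exp_neg_mul_div_add_one {ν β : ℝ} (hν : 0 < ν) (hβ : 0 < β) :
    ∫ x in Ioi (0 : ℝ), x ^ (ν - 1) * Real.exp (-(β * x)) * (1 / (x + 1)) =
      Real.Gamma ν / Real.exp (-β) * upperGamma (1 - ν) β := by
  -- Starting the `t`-integral at `β` rather than 0 produces the factor `exp (-βx)` along with `1 /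
  -- (x + 1)`.
  have hinner : ∀ x ∈ Ioi (0 : ℝ), ∫ t in Ioi β, x ^ (ν - 1) * Real.exp (-((x + 1) * t)) =
      Real.exp (-β) * (x ^ (ν - 1) * Real.exp (-(β * x)) * (1 / (x + 1))) := by
    intro x hx
    have hx : 0 < x := hx
    have := integral_exp_mul_Ioi (a := -(x + 1)) (by linarith) β
    rw [integral_const_mul]
    simp only [neg_mul] at this
    rw [this, show -((x + 1) * β) = -β + -(β * x) by ring, Real.exp_add]
    field_simp
  have houter : ∀ t ∈ Ioi β, ∫ x in Ioi (0 : ℝ), x ^ (ν - 1) * Real.exp (-((x + 1) * t)) =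
      Real.Gamma ν * (t ^ (1 - ν - 1) * Real.exp (-t)) := by
    intro t ht
    have ht : 0 < t := hβ.trans ht
    have := Real.integral_rpow_mul_exp_neg_mul_Ioi hν ht
    calc _ = ∫ x in Ioi (0 : ℝ), Real.exp (-t) * (x ^ (ν - 1) * Real.exp (-(t * x))) := by
          congr 1; ext x
          rw [show -((x + 1) * t) = -t + -(t * x) by ring, Real.exp_add]; ring
      _ = _ := by
          rw [integral_const_mul, this, show 1 - ν - 1 = -ν by ring, Real.rpow_neg ht.le,
            one_div, Real.inv_rpow ht.le]
          ring
  have hmeas : Measurable fun p : ℝ × ℝ => p.1 ^ (ν - 1) * Real.exp (-((p.1 + 1) * p.2)) := by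
    fun_prop
  have hint : Integrable (fun p : ℝ × ℝ => p.1 ^ (ν - 1) * Real.exp (-((p.1 + 1) * p.2)))
      ((volume.restrict (Ioi 0)).prod (volume.restrict (Ioi β))) := by
    have h1 := (integrableOn_rpow_mul_exp_neg_mul hν hβ)
    have h2 : IntegrableOn (fun t : ℝ => Real.exp (-t)) (Ioi β) := integrableOn_exp_neg_Ioi β
    refine (Integrable.mul_prod h1 h2).mono' hmeas.aestronglyMeasurable ?_
    rw [Measure.prod_restrict]
    filter_upwards [ae_restrict_mem (measurableSet_Ioi.prod measurableSet_Ioi)] with p hp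
    obtain ⟨hp1, hp2⟩ : 0 < p.1 ∧ β < p.2 := hp
    -- Since `t > β`, `(x + 1) * t ≥ βx + t`, which gives a product bound.
    rw [Real.norm_of_nonneg (by positivity), mul_assoc, ← Real.exp_add]
    gcongr
    nlinarith
  have hswap := integral_integral_swap
    (f := fun x t : ℝ => x ^ (ν - 1) * Real.exp (-((x + 1) * t))) hint
  rw [setIntegral_congr_fun measurableSet_Ioi hinner,
    setIntegral_congr_fun measurableSet_Ioi houter, integral_const_mul, integral_const_mul] at hswap
  rw [upperGamma, div_mul_eq_mul_div, ← hswap]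
  field_simp

/-! ### The law of a single hop. -/

namespace Hop

variable {L : ℕ} (h : Hop L)

theorem rate_pos (i : Fin L) : 0 < h.rate i :=
  div_pos (h.c_pos i) (mul_pos h.A₀_pos h.γbar_pos)

theorem Xi_nonneg (d : ℕ) (i : Fin L) (k : ℕ) : 0 ≤ h.Xi d i k := by
  have := h.a_nonneg i
  have := h.c_pos i
  have := h.ξ_pos
  have := h.A₀_pos
  have := h.γbar_pos
  unfold Xi
  positivity

theorem snrPDF_eq_sum {d : Fin L → ℕ} (hd : ∀ i, 0 < d i ∧ h.b i - h.ξ ^ 2 = d i)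
    {x : ℝ} (hx : 0 < x) :
    h.snrPDF x = ∑ i, ∑ k ∈ Finset.range (d i),
      h.Xi (d i) i k * (x ^ (h.ξ ^ 2 + k - 1) * Real.exp (-(h.rate i * x))) := by
  refine Finset.sum_congr rfl fun i _ => ?_
  have hc := h.c_pos i
  have hA : 0 < h.A₀ * h.γbar := mul_pos h.A₀_pos h.γbar_pos
  rw [(hd i).2, upperGamma_natCast (hd i).1 (by positivity), Finset.mul_sum, Finset.mul_sum]
  refine Finset.sum_congr rfl fun k _ => ?_
  rw [Xi, rate, Real.rpow_add hc, Real.rpow_add hA, add_sub_right_comm, Real.rpow_add hx,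
    Real.rpow_natCast, Real.rpow_natCast, Real.rpow_natCast, mul_pow, div_pow]
  field_simp

theorem ae_snrLaw_pos : ∀ᵐ x ∂h.snrLaw, 0 < x :=
  (withDensity_absolutelyContinuous _ _).ae_le (ae_restrict_mem measurableSet_Ioi)

theorem integral_snrLaw {d : Fin L → ℕ} (hd : ∀ i, 0 < d i ∧ h.b i - h.ξ ^ 2 = d i)
    {g : ℝ → ℝ}
    (hg : ∀ i, ∀ k < d i, IntegrableOn
      (fun x => x ^ (h.ξ ^ 2 + k - 1) * Real.exp (-(h.rate i * x)) * g x) (Ioi 0)) :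
    ∫ x, g x ∂h.snrLaw = ∑ i, ∑ k ∈ Finset.range (d i), h.Xi (d i) i k *
      ∫ x in Ioi (0 : ℝ), x ^ (h.ξ ^ 2 + k - 1) * Real.exp (-(h.rate i * x)) * g x := by
  have hcongr : (fun x => ENNReal.ofReal (h.snrPDF x)) =ᵐ[volume.restrict (Ioi 0)]
      fun x => ENNReal.ofReal (∑ i, ∑ k ∈ Finset.range (d i),
        h.Xi (d i) i k * (x ^ (h.ξ ^ 2 + k - 1) * Real.exp (-(h.rate i * x)))) := by
    filter_upwards [ae_restrict_mem measurableSet_Ioi] with x hx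
    rw [h.snrPDF_eq_sum hd hx]
  rw [snrLaw, withDensity_congr_ae hcongr, integral_withDensity_eq_integral_toReal_smul
    (by fun_prop) (by simp)]
  calc _ = ∫ x in Ioi (0 : ℝ), ∑ i, ∑ k ∈ Finset.range (d i), h.Xi (d i) i k *
        (x ^ (h.ξ ^ 2 + k - 1) * Real.exp (-(h.rate i * x)) * g x) := by
        refine setIntegral_congr_fun measurableSet_Ioi fun x hx => ?_
        have hx : 0 < x := hx
        rw [ENNReal.toReal_ofReal, smul_eq_mul, Finset.sum_mul]
        · refine Finset.sum_congr rfl fun i _ => ?_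
          rw [Finset.sum_mul]
          exact Finset.sum_congr rfl fun k _ => by ring
        -- The truncation in `ENNReal.ofReal` is harmless because the weights `a i` are nonnegative.
        · refine Finset.sum_nonneg fun i _ => Finset.sum_nonneg fun k _ => ?_
          have := h.Xi_nonneg (d i) i k
          positivity
    _ = _ := by
        have hint : ∀ i, ∀ k ∈ Finset.range (d i), IntegrableOn (fun x => h.Xi (d i) i k *
            (x ^ (h.ξ ^ 2 + k - 1) * Real.exp (-(h.rate i * x)) * g x)) (Ioi 0) :=
          fun i k hk => (hg i k (Finset.mem_range.1 hk)).const_mul _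
        rw [integral_finsetSum _ fun i _ => integrable_finsetSum _ (hint i)]
        refine Finset.sum_congr rfl fun i _ => ?_
        rw [integral_finsetSum _ (hint i)]
        exact Finset.sum_congr rfl fun k _ => integral_const_mul _ _

theorem snrLaw_real_Ioi {d : Fin L → ℕ} (hd : ∀ i, 0 < d i ∧ h.b i - h.ξ ^ 2 = d i)
    {m : ℕ} (hm : h.ξ ^ 2 = m) {x : ℝ} (hx : 0 ≤ x) :
    h.snrLaw.real (Ioi x) = ∑ i, ∑ k ∈ Finset.range (d i), ∑ r ∈ Finset.range (m + k),
      h.Xi (d i) i k * ((m + k - 1)! / ((r ! : ℝ) * h.rate i ^ (m + k))) *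
        ((h.rate i * x) ^ r * Real.exp (-(h.rate i * x))) := by
  have hm0 : 0 < m := by
    have := h.ξ_pos
    have : (0 : ℝ) < m := hm ▸ by positivity
    exact_mod_cast this
  have hν : ∀ k : ℕ, 0 < h.ξ ^ 2 + k := fun k => by have := h.ξ_pos; positivity
  rw [← integral_indicator_one measurableSet_Ioi, h.integral_snrLaw hd]
  · refine Finset.sum_congr rfl fun i _ => Finset.sum_congr rfl fun k _ => ?_
    -- As `m > 0`, the natural subtraction `m + k - 1` is a true predecessor, and the real exponent
    -- becomes a natural power.
    obtain ⟨N, hN⟩ : ∃ N, m + k = N + 1 := ⟨m + k - 1, by omega⟩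
    have hNr : h.ξ ^ 2 + k - 1 = N := by
      rw [hm]
      have : (m + k : ℝ) = N + 1 := by exact_mod_cast hN
      linarith
    have hset : ∫ y in Ioi (0 : ℝ), y ^ (h.ξ ^ 2 + k - 1) * Real.exp (-(h.rate i * y)) *
        (Ioi x).indicator 1 y = ∫ y in Ioi x, y ^ N * Real.exp (-(h.rate i * y)) := by
      have : ∀ y, y ^ (h.ξ ^ 2 + k - 1) * Real.exp (-(h.rate i * y)) * (Ioi x).indicator 1 y =
          (Ioi x).indicator (fun y => y ^ N * Real.exp (-(h.rate i * y))) y := by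
        intro y
        by_cases hy : y ∈ Ioi x <;> simp [hy, hNr]
      simp_rw [this]
      rw [setIntegral_indicator measurableSet_Ioi, inter_eq_right.2 (Ioi_subset_Ioi hx)]
    rw [hset, integral_Ioi_pow_mul_exp_neg_mul N (h.rate_pos i) hx, hN, Finset.mul_sum,
      Finset.sum_div, Finset.mul_sum]
    refine Finset.sum_congr rfl fun r _ => ?_
    have := h.rate_pos i
    simp only [Nat.add_sub_cancel]
    field_simp
  · intro i k _
    refine ((integrableOn_rpow_mul_exp_neg_mul (hν k) (h.rate_pos i)).indicator
      (measurableSet_Ioi (a := x))).congr (.of_forall fun y => ?_)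
    by_cases hy : y ∈ Ioi x <;> simp [hy]

end Hop

/-! ### Whittaker integrals. -/

/-- Representation of Whittaker's function by a Laplace-type integral in which the algebraic
factor is a function of `1 / y`. -/
theorem integral_rpow_mul_exp_mul_add_div_rpow {n p B C β : ℝ} (hnp : 0 < n + p)
    (hB : 0 < B) (hC : 0 < C) (hβ : 0 < β) :
    ∫ y in Ioi (0 : ℝ), y ^ (n - 1) * Real.exp (-(β * y)) * (B + C / y) ^ (-p) =
      (C / B) ^ n * B ^ (-p) * Real.Gamma (n + p) * Real.exp (β * C / B / 2) *
        (β * C / B) ^ (-(n + 1) / 2) * whittakerW (-(n + 2 * p - 1) / 2) (n / 2) (β * C / B) := by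
  set z := β * C / B with hz
  have hz0 : 0 < z := by positivity
  -- The substitution `y = w * t` turns `B + C / y` into `B * (1 + t) / t`.
  set w := C / B with hw
  have hw0 : 0 < w := by positivity
  have h1 := integral_comp_mul_left_Ioi
    (fun y : ℝ => y ^ (n - 1) * Real.exp (-(β * y)) * (B + C / y) ^ (-p)) 0 hw0
  have h2 : ∫ t in Ioi (0 : ℝ), (w * t) ^ (n - 1) * Real.exp (-(β * (w * t))) *
      (B + C / (w * t)) ^ (-p) = w ^ (n - 1) * B ^ (-p) *
      ∫ t in Ioi (0 : ℝ), Real.exp (-(z * t)) * t ^ (n + p - 1) * (1 + t) ^ (-p) := by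
    rw [← integral_const_mul]
    refine setIntegral_congr_fun measurableSet_Ioi fun t ht => ?_
    have ht : 0 < t := ht
    have e1 : B + C / (w * t) = B * ((1 + t) * t⁻¹) := by rw [hw]; field_simp; ring
    have e2 : β * (w * t) = z * t := by rw [hw, hz]; ring
    rw [e1, e2, Real.mul_rpow hw0.le ht.le, Real.mul_rpow hB.le (by positivity),
      Real.mul_rpow (by positivity) (by positivity), Real.inv_rpow ht.le, Real.rpow_neg ht.le,
      inv_inv, show n + p - 1 = (n - 1) + p by ring, Real.rpow_add ht]
    ring
  simp only [mul_zero, smul_eq_mul] at h1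
  rw [h2] at h1
  have hW : whittakerW (-(n + 2 * p - 1) / 2) (n / 2) z =
      Real.exp (-z / 2) * z ^ ((n + 1) / 2) / Real.Gamma (n + p) *
        ∫ t in Ioi (0 : ℝ), Real.exp (-(z * t)) * t ^ (n + p - 1) * (1 + t) ^ (-p) := by
    rw [whittakerW, show n / 2 - -(n + 2 * p - 1) / 2 + 1 / 2 = n + p by ring,
      show n / 2 - -(n + 2 * p - 1) / 2 - 1 / 2 = n + p - 1 by ring,
      show n / 2 + -(n + 2 * p - 1) / 2 - 1 / 2 = -p by ring, add_div]
  rw [hW]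
  have hG := (Real.Gamma_pos_of_pos hnp).ne'
  have e3 : z ^ (-(n + 1) / 2) * z ^ ((n + 1) / 2) = 1 := by
    rw [← Real.rpow_add hz0, show -(n + 1) / 2 + (n + 1) / 2 = 0 by ring, Real.rpow_zero]
  have e4 : Real.exp (z / 2) * Real.exp (-z / 2) = 1 := by
    rw [← Real.exp_add, show z / 2 + -z / 2 = 0 by ring, Real.exp_zero]
  have e5 : w ^ n = w * w ^ (n - 1) := by
    rw [Real.rpow_sub_one hw0.ne', mul_div_cancel₀ _ hw0.ne']
  set I := ∫ t in Ioi (0 : ℝ), Real.exp (-(z * t)) * t ^ (n + p - 1) * (1 + t) ^ (-p)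
  have h3 := congrArg (w * ·) h1
  simp only [← mul_assoc, mul_inv_cancel₀ hw0.ne', one_mul] at h3
  rw [← h3, ← e5]
  calc w ^ n * B ^ (-p) * I = w ^ n * B ^ (-p) * I * (Real.exp (z / 2) * Real.exp (-z / 2)) *
        (z ^ (-(n + 1) / 2) * z ^ ((n + 1) / 2)) := by rw [e3, e4]; ring
    _ = _ := by field_simp

/-- Near 0 the last factor decays like `y ^ p`, so only `n + p` has to be positive. This matters
because the binomial index `s` can make `n` negative. -/
theorem integrableOn_rpow_mul_exp_mul_add_div_rpow {n p B C β : ℝ} (hnp : 0 < n + p)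
    (hp : 0 ≤ p) (hB : 0 < B) (hC : 0 < C) (hβ : 0 < β) :
    IntegrableOn (fun y : ℝ => y ^ (n - 1) * Real.exp (-(β * y)) * (B + C / y) ^ (-p)) (Ioi 0) := by
  have h1 := (integrableOn_rpow_mul_exp_neg_mul hnp hβ).mul_const (C ^ (-p))
  refine h1.mono' (by fun_prop) ?_
  filter_upwards [ae_restrict_mem measurableSet_Ioi] with y hy
  have hy : 0 < y := hy
  rw [Real.norm_of_nonneg (by positivity)]
  have h2 : (B + C / y) ^ (-p) ≤ (C / y) ^ (-p) :=
    Real.rpow_le_rpow_of_nonpos (by positivity) (by linarith) (by linarith)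
  have h3 : y ^ (n + p - 1) = y ^ (n - 1) * y ^ p := by
    rw [← Real.rpow_add hy]; ring_nf
  rw [Real.div_rpow hC.le hy.le, Real.rpow_neg hy.le, div_inv_eq_mul] at h2
  rw [h3]
  calc _ ≤ y ^ (n - 1) * Real.exp (-(β * y)) * (C ^ (-p) * y ^ p) := by gcongr
    _ = _ := by ring

/-! ### Averaging against a Gamma weight. -/

/-- Averaging `x ↦ x ^ r * exp (-x)`, evaluated at `β * z * v`, first over `v` and then over `z`
with a Gamma weight: integrability of the outer integrand. -/
theorem integrable_prod_gamma_weight {α : Type*} [MeasurableSpace α] {ν : Measure α}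
    [IsFiniteMeasure ν] {v : α → ℝ} (hv : Measurable v) (hv0 : ∀ᵐ y ∂ν, 0 ≤ v y)
    {P Q β : ℝ} (hP : 0 < P) (hQ : 0 < Q) (hβ : 0 < β) (r : ℕ) :
    Integrable (fun p : ℝ × α => p.1 ^ (P - 1) * Real.exp (-(Q * p.1)) *
      ((β * (p.1 * v p.2)) ^ r * Real.exp (-(β * (p.1 * v p.2)))))
      ((volume.restrict (Ioi 0)).prod ν) := by
  have h1 := (integrableOn_rpow_mul_exp_neg_mul hP hQ).mul_prod (integrable_const (μ := ν) (r ! : ℝ))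
  refine h1.mono' (by fun_prop) ?_
  have hz : ∀ᵐ p ∂((volume.restrict (Ioi (0 : ℝ))).prod ν), 0 < p.1 :=
    Measure.quasiMeasurePreserving_fst.ae (ae_restrict_mem measurableSet_Ioi)
  have hy : ∀ᵐ p ∂((volume.restrict (Ioi (0 : ℝ))).prod ν), 0 ≤ v p.2 :=
    Measure.quasiMeasurePreserving_snd.ae hv0
  filter_upwards [hz, hy] with p hp1 hp2
  rw [Real.norm_of_nonneg (by positivity)]
  -- The bound `x ^ r * exp (-x) ≤ r !` is uniform in `v`, so no moment of `v` is needed.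
  have := Real.pow_div_factorial_le_exp (β * (p.1 * v p.2)) (by positivity) r
  gcongr
  rw [Real.exp_neg, ← div_eq_mul_inv, div_le_iff₀ (by positivity)]
  rwa [div_le_iff₀' (by positivity)] at this

theorem integral_gamma_weight {α : Type*} [MeasurableSpace α] {ν : Measure α}
    [IsFiniteMeasure ν] {v : α → ℝ} (hv : Measurable v) (hv0 : ∀ᵐ y ∂ν, 0 ≤ v y)
    {P Q β : ℝ} (hP : 0 < P) (hQ : 0 < Q) (hβ : 0 < β) (r : ℕ) :
    ∫ z in Ioi (0 : ℝ), z ^ (P - 1) * Real.exp (-(Q * z)) *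
      ∫ y, (β * (z * v y)) ^ r * Real.exp (-(β * (z * v y))) ∂ν =
    β ^ r * Real.Gamma (r + P) * ∫ y, v y ^ r * (Q + β * v y) ^ (-(P + r)) ∂ν := by
  simp_rw [← integral_const_mul]
  rw [integral_integral_swap (integrable_prod_gamma_weight hv hv0 hP hQ hβ r)]
  refine integral_congr_ae ?_
  filter_upwards [hv0] with y hy
  have h1 := Real.integral_rpow_mul_exp_neg_mul_Ioi (a := P + r) (r := Q + β * v y)
    (by positivity) (by positivity)
  calc _ = ∫ z in Ioi (0 : ℝ), (β ^ r * v y ^ r) *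
        (z ^ (P + r - 1) * Real.exp (-((Q + β * v y) * z))) := by
        refine setIntegral_congr_fun measurableSet_Ioi fun z hz => ?_
        have hz : 0 < z := hz
        rw [show P + r - 1 = P - 1 + r by ring, Real.rpow_add hz, Real.rpow_natCast,
          show -((Q + β * v y) * z) = -(Q * z) + -(β * (z * v y)) by ring, Real.exp_add, mul_pow,
          mul_pow]
        ring
    _ = _ := by
        rw [integral_const_mul, h1, one_div, Real.inv_rpow (by positivity),
          Real.rpow_neg (by positivity), add_comm P r]
        ring

/-! ### The gain constant. -/

theorem Hop.gainConstant_pos_and_eq {Ω : Type*} [MeasurableSpace Ω] {μ : Measure Ω}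
    [IsProbabilityMeasure μ] {L : ℕ} {h : Hop L} {γ : Ω → ℝ} (hγ : HasLaw γ h.snrLaw μ)
    {d : Fin L → ℕ} (hd : ∀ i, 0 < d i ∧ h.b i - h.ξ ^ 2 = d i) :
    0 < gainConstant μ γ ∧ gainConstant μ γ =
      (∑ i, ∑ k ∈ Finset.range (d i),
        h.Xi (d i) i k * Real.Gamma (h.ξ ^ 2 + k) / Real.exp (-h.rate i)
          * upperGamma (1 - h.ξ ^ 2 - k) (h.rate i))⁻¹ := by
  have hpos : ∀ᵐ ω ∂μ, 0 < γ ω := (hγ.ae_iff measurableSet_Ioi.mem).2 h.ae_snrLaw_pos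
  have hm := hγ.aemeasurable
  refine ⟨inv_pos.2 ?_, ?_⟩
  · have hint : Integrable (fun ω => 1 / (γ ω + 1)) μ := by
      refine (integrable_const (1 : ℝ)).mono'
        ((hm.add_const 1).const_div 1).aestronglyMeasurable ?_
      filter_upwards [hpos] with ω hω
      rw [Real.norm_of_nonneg (by positivity), div_le_one (by positivity)]
      linarith
    rw [integral_pos_iff_support_of_nonneg_ae
      (by filter_upwards [hpos] with ω hω; simp only [Pi.zero_apply]; positivity) hint]
    have : Function.support (fun ω => 1 / (γ ω + 1)) =ᵐ[μ] univ := by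
      refine Filter.eventuallyEq_univ.2 ?_
      filter_upwards [hpos] with ω hω
      exact one_div_ne_zero (by positivity)
    rw [measure_congr this]
    simp
  · have h1 := hγ.integral_comp (f := fun x : ℝ => 1 / (x + 1))
      ((measurable_id.add_const 1).const_div 1).aestronglyMeasurable
    rw [gainConstant, show (∫ ω, 1 / (γ ω + 1) ∂μ) = _ from h1, h.integral_snrLaw hd]
    · congr 1
      refine Finset.sum_congr rfl fun i _ => Finset.sum_congr rfl fun k _ => ?_
      have := h.ξ_pos
      rw [integral_rpow_mul_exp_neg_mul_div_add_one (by positivity) (h.rate_pos i), sub_sub]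
      ring
    · intro i k _
      have := h.ξ_pos
      have hν : 0 < h.ξ ^ 2 + k := by positivity
      refine (integrableOn_rpow_mul_exp_neg_mul hν (h.rate_pos i)).mono' (by fun_prop) ?_
      filter_upwards [ae_restrict_mem measurableSet_Ioi] with y hy
      have hy : 0 < y := hy
      rw [Real.norm_of_nonneg (by positivity)]
      refine mul_le_of_le_one_right (by positivity) ?_
      rw [div_le_one (by positivity)]
      linarith

/-! ### Distribution function and error rate of the relayed SNR. -/

theorem measureReal_snrFixed_le {Ω : Type*} [MeasurableSpace Ω] {μ : Measure Ω}
    [IsProbabilityMeasure μ] {ρ₁ ρ₂ : Measure ℝ} {X Y : Ω → ℝ} (hX : HasLaw X ρ₁ μ)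
    (hY : HasLaw Y ρ₂ μ) (hXY : IndepFun X Y μ) (hρ₂ : ∀ᵐ y ∂ρ₂, 0 < y) {U : ℝ} (hU : 0 < U)
    (z : ℝ) :
    μ.real {ω | snrFixed U X Y ω ≤ z} = 1 - ∫ y, ρ₁.real (Ioi (z * (1 + U / y))) ∂ρ₂ := by
  -- Total mass 1 is inherited from `μ` through the random variables.
  have : IsProbabilityMeasure ρ₁ := hX.isProbabilityMeasure_iff.1 ‹_›
  have : IsProbabilityMeasure ρ₂ := hY.isProbabilityMeasure_iff.1 ‹_›
  have hpos : ∀ᵐ ω ∂μ, 0 < Y ω := (hY.ae_iff measurableSet_Ioi.mem).2 hρ₂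
  set A : Set (ℝ × ℝ) := {p | z * (1 + U / p.2) < p.1} with hA
  have hAm : MeasurableSet A := measurableSet_lt (by fun_prop) (by fun_prop)
  have h1 : {ω | snrFixed U X Y ω ≤ z} =ᵐ[μ] {ω | (X ω, Y ω) ∈ Aᶜ} := by
    filter_upwards [hpos] with ω hω
    refine propext (?_ : snrFixed U X Y ω ≤ z ↔ ¬ z * (1 + U / Y ω) < X ω)
    rw [not_lt, snrFixed, div_le_iff₀ (by positivity), ← mul_le_mul_iff_of_pos_right hω]
    field_simp
  have hlaw : HasLaw (fun ω => (X ω, Y ω)) (ρ₁.prod ρ₂) μ :=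
    (indepFun_iff_hasLaw_prodMk_prod hX hY).1 hXY
  rw [measureReal_congr h1, hlaw.measureReal_eq (p := (· ∈ Aᶜ)) hAm.compl, ofPred_mem_eq,
    probReal_compl_eq_one_sub hAm, measureReal_def, Measure.prod_apply_symm hAm]
  congr 1
  rw [← integral_toReal (measurable_measure_prodMk_right hAm).aemeasurable
    (.of_forall fun y => measure_lt_top _ _)]
  rfl

theorem Hop.integral_snrLaw_pow_mul_rpow {L : ℕ} (h : Hop L) {d : Fin L → ℕ}
    (hd : ∀ i, 0 < d i ∧ h.b i - h.ξ ^ 2 = d i) {U P Q β : ℝ} (hU : 0 < U) (hP : 0 < P)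
    (hQ : 0 < Q) (hβ : 0 < β) (r : ℕ) :
    ∫ y, (1 + U / y) ^ r * (Q + β * (1 + U / y)) ^ (-(P + r)) ∂h.snrLaw =
      ∑ i, ∑ k ∈ Finset.range (d i), ∑ s ∈ Finset.range (r + 1),
        h.Xi (d i) i k * (r.choose s * U ^ s *
          ∫ y in Ioi (0 : ℝ), y ^ (h.ξ ^ 2 + k - s - 1) * Real.exp (-(h.rate i * y)) *
            ((β + Q) + β * U / y) ^ (-(P + r))) := by
  have hexp : ∀ (i : Fin L) (k : ℕ), ∀ y ∈ Ioi (0 : ℝ),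
      ∑ s ∈ Finset.range (r + 1), r.choose s * U ^ s *
        (y ^ (h.ξ ^ 2 + k - s - 1) * Real.exp (-(h.rate i * y)) *
            ((β + Q) + β * U / y) ^ (-(P + r))) =
      y ^ (h.ξ ^ 2 + k - 1) * Real.exp (-(h.rate i * y)) *
        ((1 + U / y) ^ r * (Q + β * (1 + U / y)) ^ (-(P + r))) := by
    intro i k y hy
    have hy : 0 < y := hy
    rw [add_comm 1 (U / y), add_pow, Finset.sum_mul, Finset.mul_sum]
    refine Finset.sum_congr rfl fun s _ => ?_
    rw [show h.ξ ^ 2 + k - s - 1 = h.ξ ^ 2 + k - 1 - s by ring, Real.rpow_sub hy,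
      Real.rpow_natCast, show Q + β * (U / y + 1) = β + Q + β * U / y by ring, div_pow, one_pow]
    ring
  have hint : ∀ (i : Fin L) (k : ℕ), ∀ s ∈ Finset.range (r + 1), IntegrableOn (fun y : ℝ =>
      r.choose s * U ^ s * (y ^ (h.ξ ^ 2 + k - s - 1) * Real.exp (-(h.rate i * y)) *
            ((β + Q) + β * U / y) ^ (-(P + r)))) (Ioi 0) := by
    intro i k s hs
    refine (integrableOn_rpow_mul_exp_mul_add_div_rpow ?_ (by positivity) (by positivity)
      (by positivity) (h.rate_pos i)).const_mul _
    have hsr : (s : ℝ) ≤ r := by exact_mod_cast Finset.mem_range_succ_iff.1 hs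
    have := h.ξ_pos
    have : 0 < h.ξ ^ 2 + k + P := by positivity
    linarith
  rw [h.integral_snrLaw hd]
  · refine Finset.sum_congr rfl fun i _ => Finset.sum_congr rfl fun k _ => ?_
    rw [← setIntegral_congr_fun measurableSet_Ioi (hexp i k), integral_finsetSum _ (hint i k),
      Finset.mul_sum]
    exact Finset.sum_congr rfl fun s _ => by rw [integral_const_mul]
  · intro i k _
    exact IntegrableOn.congr_fun (integrable_finsetSum _ (hint i k)) (hexp i k) measurableSet_Ioi

/-- All bases are positive, so taking logarithms reduces this to a polynomial identity in the
exponents and the logs of `β₁`, `β₂`, `U` and `β₁ + Q`. -/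
theorem rpow_factors_eq {β₁ β₂ U Q P n : ℝ} (hβ₁ : 0 < β₁) (hβ₂ : 0 < β₂) (hU : 0 < U)
    (hQ : 0 < Q) (N r s : ℕ) :
    β₁ ^ r / β₁ ^ N * U ^ s * ((β₁ * U / (β₁ + Q)) ^ n * (β₁ + Q) ^ (-(P + r)) *
      (β₂ * (β₁ * U) / (β₁ + Q)) ^ (-(n + 1) / 2)) =
    β₁ ^ ((n - 1) / 2 + r - N) * U ^ ((n + 2 * s - 1) / 2) /
      (β₂ ^ ((n + 1) / 2) * (β₁ + Q) ^ ((n + 2 * r + 2 * P - 1) / 2)) := by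
  have hB : 0 < β₁ + Q := by positivity
  rw [← Real.rpow_natCast β₁, ← Real.rpow_natCast β₁, ← Real.rpow_natCast U]
  have h1 : 0 < β₁ * U / (β₁ + Q) := by positivity
  have h2 : 0 < β₂ * (β₁ * U) / (β₁ + Q) := by positivity
  simp only [Real.rpow_def_of_pos, hβ₁, hβ₂, hU, hB, h1, h2, ← Real.exp_add,
    ← Real.exp_sub]
  rw [Real.log_div (by positivity) (by positivity), Real.log_div (by positivity) (by positivity),
    Real.log_mul (by positivity) (by positivity), Real.log_mul (by positivity) (by positivity),
    Real.log_mul (by positivity) (by positivity)]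
  ring_nf

theorem aber_snrFixed_eq {Ω : Type*} [MeasurableSpace Ω] {μ : Measure Ω} [IsProbabilityMeasure μ]
    {L : ℕ} {h : Hop L} {ρ : Measure ℝ} {X Y : Ω → ℝ} (hX : HasLaw X h.snrLaw μ)
    (hY : HasLaw Y ρ μ) (hXY : IndepFun X Y μ) (hρ : ∀ᵐ y ∂ρ, 0 < y)
    {d : Fin L → ℕ} (hd : ∀ i, 0 < d i ∧ h.b i - h.ξ ^ 2 = d i) {m : ℕ} (hm : h.ξ ^ 2 = m)
    {P Q U : ℝ} (hP : 0 < P) (hQ : 0 < Q) (hU : 0 < U) :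
    aber μ P Q (snrFixed U X Y) =
      1 / 2 - ∑ i, ∑ k ∈ Finset.range (d i), ∑ r ∈ Finset.range (m + k),
        Q ^ P / (2 * Real.Gamma P) *
        (h.Xi (d i) i k * ((m + k - 1)! / ((r ! : ℝ) * h.rate i ^ (m + k))) *
          (h.rate i ^ r * Real.Gamma (r + P) *
            ∫ y, (1 + U / y) ^ r * (Q + h.rate i * (1 + U / y)) ^ (-(P + r)) ∂ρ)) := by
  have : IsProbabilityMeasure ρ := hY.isProbabilityMeasure_iff.1 ‹_›
  have hv : Measurable fun y : ℝ => 1 + U / y := by fun_prop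
  have hv0 : ∀ᵐ y ∂ρ, 0 ≤ 1 + U / y := hρ.mono fun y hy => by positivity
  have hprod := fun i r => integrable_prod_gamma_weight hv hv0 hP hQ (h.rate_pos i) r
  have htail : ∀ z ∈ Ioi (0 : ℝ), ∫ y, h.snrLaw.real (Ioi (z * (1 + U / y))) ∂ρ =
      ∑ i, ∑ k ∈ Finset.range (d i), ∑ r ∈ Finset.range (m + k),
        h.Xi (d i) i k * ((m + k - 1)! / ((r ! : ℝ) * h.rate i ^ (m + k))) *
          ∫ y, (h.rate i * (z * (1 + U / y))) ^ r *
            Real.exp (-(h.rate i * (z * (1 + U / y)))) ∂ρ := by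
    intro z hz
    have hz : 0 < z := hz
    have hint : ∀ i r, Integrable (fun y => (h.rate i * (z * (1 + U / y))) ^ r *
        Real.exp (-(h.rate i * (z * (1 + U / y))))) ρ := by
      intro i r
      refine (integrable_const (r ! : ℝ)).mono' (by fun_prop) ?_
      filter_upwards [hv0] with y hy
      have hi := h.rate_pos i
      rw [Real.norm_of_nonneg (by positivity)]
      have := Real.pow_div_factorial_le_exp (h.rate i * (z * (1 + U / y))) (by positivity) r
      rw [Real.exp_neg, ← div_eq_mul_inv, div_le_iff₀ (by positivity)]
      rwa [div_le_iff₀' (by positivity)] at this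
    rw [integral_congr_ae (hv0.mono fun y hy => h.snrLaw_real_Ioi hd hm (mul_nonneg hz.le hy)),
      integral_finsetSum _ fun i _ => integrable_finsetSum _ fun k _ =>
        integrable_finsetSum _ fun r _ => (hint i r).const_mul _]
    refine Finset.sum_congr rfl fun i _ => ?_
    rw [integral_finsetSum _ fun k _ => integrable_finsetSum _ fun r _ => (hint i r).const_mul _]
    refine Finset.sum_congr rfl fun k _ => ?_
    rw [integral_finsetSum _ fun r _ => (hint i r).const_mul _]
    exact Finset.sum_congr rfl fun r _ => integral_const_mul _ _
  have hterm : ∀ i (k r : ℕ), IntegrableOn (fun z => h.Xi (d i) i k *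
      ((m + k - 1)! / ((r ! : ℝ) * h.rate i ^ (m + k))) *
      (z ^ (P - 1) * Real.exp (-(Q * z)) * ∫ y, (h.rate i * (z * (1 + U / y))) ^ r *
            Real.exp (-(h.rate i * (z * (1 + U / y)))) ∂ρ)) (Ioi 0) := by
    intro i k r
    -- Integrability in `z` of the inner mean is the marginal half of Fubini.
    have := (hprod i r).integral_prod_left
    simp only [integral_const_mul] at this
    exact this.const_mul _
  have hint : ∫ z in Ioi (0 : ℝ), z ^ (P - 1) * Real.exp (-(Q * z)) *
      μ.real {ω | snrFixed U X Y ω ≤ z} = Real.Gamma P / Q ^ P -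
      ∑ i, ∑ k ∈ Finset.range (d i), ∑ r ∈ Finset.range (m + k),
        h.Xi (d i) i k * ((m + k - 1)! / ((r ! : ℝ) * h.rate i ^ (m + k))) *
          (h.rate i ^ r * Real.Gamma (r + P) *
            ∫ y, (1 + U / y) ^ r * (Q + h.rate i * (1 + U / y)) ^ (-(P + r)) ∂ρ) := by
    calc _ = ∫ z in Ioi (0 : ℝ), (z ^ (P - 1) * Real.exp (-(Q * z)) -
        ∑ i, ∑ k ∈ Finset.range (d i), ∑ r ∈ Finset.range (m + k),
          h.Xi (d i) i k * ((m + k - 1)! / ((r ! : ℝ) * h.rate i ^ (m + k))) *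
            (z ^ (P - 1) * Real.exp (-(Q * z)) * ∫ y, (h.rate i * (z * (1 + U / y))) ^ r *
              Real.exp (-(h.rate i * (z * (1 + U / y)))) ∂ρ)) := by
          refine setIntegral_congr_fun measurableSet_Ioi fun z hz => ?_
          rw [measureReal_snrFixed_le hX hY hXY hρ hU, htail z hz, mul_sub, mul_one]
          simp only [Finset.mul_sum]
          congr 1
          refine Finset.sum_congr rfl fun i _ => Finset.sum_congr rfl fun k _ =>
            Finset.sum_congr rfl fun r _ => by ring
      _ = _ := by
          rw [integral_sub (integrableOn_rpow_mul_exp_neg_mul hP hQ)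
            (integrable_finsetSum _ fun i _ => integrable_finsetSum _ fun k _ =>
              integrable_finsetSum _ fun r _ => hterm i k r),
            Real.integral_rpow_mul_exp_neg_mul_Ioi hP hQ, one_div, Real.inv_rpow hQ.le,
            integral_finsetSum _ fun i _ => integrable_finsetSum _ fun k _ =>
              integrable_finsetSum _ fun r _ => hterm i k r]
          congr 1
          · ring
          refine Finset.sum_congr rfl fun i _ => ?_
          rw [integral_finsetSum _ fun k _ => integrable_finsetSum _ fun r _ => hterm i k r]
          refine Finset.sum_congr rfl fun k _ => ?_
          rw [integral_finsetSum _ fun r _ => hterm i k r]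
          refine Finset.sum_congr rfl fun r _ => ?_
          rw [integral_const_mul, integral_gamma_weight hv hv0 hP hQ (h.rate_pos i)]
  have hG := Real.Gamma_pos_of_pos hP
  have hQP : 0 < Q ^ P := by positivity
  rw [aber, hint, mul_sub]
  simp only [Finset.mul_sum]
  congr 1
  field_simp

theorem proposition2 {Ω : Type*} [MeasurableSpace Ω] (μ : Measure Ω) [IsProbabilityMeasure μ]
    {L : ℕ} (h₁ h₂ : Hop L) (γ₁ γ₂ : Ω → ℝ)
    (hγ₁ : HasLaw γ₁ h₁.snrLaw μ) (hγ₂ : HasLaw γ₂ h₂.snrLaw μ) (hind : IndepFun γ₁ γ₂ μ)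
    (d₁ d₂ : Fin L → ℕ)
    (hd₁ : ∀ i, 0 < d₁ i ∧ h₁.b i - h₁.ξ ^ 2 = d₁ i)
    (hd₂ : ∀ i, 0 < d₂ i ∧ h₂.b i - h₂.ξ ^ 2 = d₂ i)
    (m₁ : ℕ) (hm₁ : h₁.ξ ^ 2 = m₁)
    (P Q : ℝ) (hP : 0 < P) (hQ : 0 < Q) :
    (0 < gainConstant μ γ₁ ∧
      gainConstant μ γ₁ =
        (∑ i₁, ∑ k₁ ∈ Finset.range (d₁ i₁),
          h₁.Xi (d₁ i₁) i₁ k₁ * Real.Gamma (h₁.ξ ^ 2 + k₁) / Real.exp (-h₁.rate i₁)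
            * upperGamma (1 - h₁.ξ ^ 2 - k₁) (h₁.rate i₁))⁻¹) ∧
    ∀ U : ℝ, 0 < U →
      aber μ P Q (snrFixed U γ₁ γ₂) =
        1 / 2 - ∑ i₁, ∑ k₁ ∈ Finset.range (d₁ i₁), ∑ r₁ ∈ Finset.range (m₁ + k₁),
          ∑ i₂, ∑ k₂ ∈ Finset.range (d₂ i₂), ∑ s ∈ Finset.range (r₁ + 1),
            (r₁.choose s : ℝ) * h₁.Xi (d₁ i₁) i₁ k₁ * h₂.Xi (d₂ i₂) i₂ k₂
            * (((m₁ + k₁ - 1)! : ℝ)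
                * h₁.rate i₁ ^ ((h₂.ξ ^ 2 + k₂ - s - 1) / 2 + r₁ - h₁.ξ ^ 2 - k₁)
                * U ^ ((h₂.ξ ^ 2 + k₂ + s - 1) / 2) * Q ^ P
                * Real.Gamma (h₂.ξ ^ 2 + k₂ - s + r₁ + P) * Real.Gamma (r₁ + P)
              / (2 * (r₁ ! : ℝ) * Real.Gamma P
                * h₂.rate i₂ ^ ((h₂.ξ ^ 2 + k₂ - s + 1) / 2)
                * (h₁.rate i₁ + Q) ^ ((h₂.ξ ^ 2 + k₂ - s + 2 * r₁ + 2 * P - 1) / 2)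
                * Real.exp (-(h₁.rate i₁ * h₂.rate i₂ * U / (2 * (h₁.rate i₁ + Q))))))
            * whittakerW (-(h₂.ξ ^ 2 + k₂ - s + 2 * r₁ + 2 * P - 1) / 2)
                ((h₂.ξ ^ 2 + k₂ - s) / 2)
                (h₁.rate i₁ * h₂.rate i₂ * U / (h₁.rate i₁ + Q)) := by
  refine ⟨Hop.gainConstant_pos_and_eq hγ₁ hd₁, fun U hU => ?_⟩
  rw [aber_snrFixed_eq hγ₁ hγ₂ hind h₂.ae_snrLaw_pos hd₁ hm₁ hP hQ hU]
  congr 1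
  refine Finset.sum_congr rfl fun i₁ _ => Finset.sum_congr rfl fun k₁ _ =>
    Finset.sum_congr rfl fun r₁ _ => ?_
  have hβ₁ := h₁.rate_pos i₁
  rw [h₂.integral_snrLaw_pow_mul_rpow hd₂ hU hP hQ hβ₁]
  simp only [Finset.mul_sum]
  refine Finset.sum_congr rfl fun i₂ _ => Finset.sum_congr rfl fun k₂ _ =>
    Finset.sum_congr rfl fun s hs => ?_
  have hβ₂ := h₂.rate_pos i₂
  have hsr : (s : ℝ) ≤ r₁ := by exact_mod_cast Finset.mem_range_succ_iff.1 hs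
  have hn : 0 < h₂.ξ ^ 2 + k₂ - s + (P + r₁) := by
    have := h₂.ξ_pos
    have : 0 < h₂.ξ ^ 2 + k₂ + P := by positivity
    linarith
  rw [integral_rpow_mul_exp_mul_add_div_rpow hn (by positivity) (by positivity) hβ₂]
  have hpow := rpow_factors_eq (P := P) (n := h₂.ξ ^ 2 + k₂ - s) hβ₁ hβ₂ hU hQ (m₁ + k₁) r₁ s
  rw [hm₁]
  have e1 : (h₂.ξ ^ 2 + k₂ - s - 1) / 2 + r₁ - m₁ - k₁ =
      (h₂.ξ ^ 2 + k₂ - s - 1) / 2 + r₁ - (m₁ + k₁ : ℕ) := by push_cast; ring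
  have e2 : (h₂.ξ ^ 2 + k₂ + s - 1) / 2 = (h₂.ξ ^ 2 + k₂ - s + 2 * s - 1) / 2 := by ring
  have e3 : -(h₂.ξ ^ 2 + k₂ - s + 2 * (P + r₁) - 1) / 2 =
      -(h₂.ξ ^ 2 + k₂ - s + 2 * r₁ + 2 * P - 1) / 2 := by ring
  have e4 : h₂.ξ ^ 2 + k₂ - s + (P + r₁) = h₂.ξ ^ 2 + k₂ - s + r₁ + P := by ring
  have e5 : h₁.rate i₁ * h₂.rate i₂ * U / (h₁.rate i₁ + Q) =
      h₂.rate i₂ * (h₁.rate i₁ * U) / (h₁.rate i₁ + Q) := by ring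
  have e6 : h₁.rate i₁ * h₂.rate i₂ * U / (2 * (h₁.rate i₁ + Q)) =
      h₂.rate i₂ * (h₁.rate i₁ * U) / (h₁.rate i₁ + Q) / 2 := by field_simp
  rw [e1, e2, e3, e4, e5, e6, Real.exp_neg]
  set W := whittakerW (-(h₂.ξ ^ 2 + k₂ - s + 2 * r₁ + 2 * P - 1) / 2)
    ((h₂.ξ ^ 2 + k₂ - s) / 2) (h₂.rate i₂ * (h₁.rate i₁ * U) / (h₁.rate i₁ + Q))
  set E := Real.exp (h₂.rate i₂ * (h₁.rate i₁ * U) / (h₁.rate i₁ + Q) / 2)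
  -- `F` gathers every factor untouched by `rpow_factors_eq`, leaving only the powers of the rates,
  -- `U` and `β₁ + Q` to compare.
  set F := (r₁.choose s : ℝ) * h₁.Xi (d₁ i₁) i₁ k₁ * h₂.Xi (d₂ i₂) i₂ k₂ * (m₁ + k₁ - 1)! * Q ^ P *
    Real.Gamma (h₂.ξ ^ 2 + k₂ - s + r₁ + P) * Real.Gamma (r₁ + P) /
      (2 * r₁ ! * Real.Gamma P) * E * W with hF
  trans F * (h₁.rate i₁ ^ r₁ / h₁.rate i₁ ^ (m₁ + k₁) * U ^ s *
    ((h₁.rate i₁ * U / (h₁.rate i₁ + Q)) ^ (h₂.ξ ^ 2 + k₂ - s) *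
      (h₁.rate i₁ + Q) ^ (-(P + r₁)) * (h₂.rate i₂ * (h₁.rate i₁ * U) / (h₁.rate i₁ + Q)) ^
        (-(h₂.ξ ^ 2 + k₂ - s + 1) / 2)))
  · rw [hF]; field_simp
  · rw [hpow, hF]
    simp only [div_eq_mul_inv, mul_inv, inv_inv]
    ring
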